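/- A \emph{closed Deutsch path} of length $n$ is a lattice path with $n$ steps that starts at the origin, uses the up-step $(1,1)$ and the down-steps $(1,-j)$, $j\ge 1$, never goes below the $x$-axis, and ends on the $x$-axis. An \emph{up-run} of a path is a maximal sequence of consecutive up-steps. Let $d_n$ be the number of closed Deutsch paths of length $n$, let $s_n$ be the total number of up-runs of length exactly one in all of them, and let $\Phi(z,t)=\sum_{P} z^{\mathrm{length}(P)}\,t^{\#\{\text{up-runs of length one in }P\}}$, the sum being over all closed Deutsch paths $P$; thus $d_n=[z^n]\Phi(z,1)$ and $s_n=[z^n]\,\partial_t\Phi(z,t)|_{t=1}$. There is exactly one formal power series $v=v(z)$ (with real coefficients) such that $z=\dfrac{v}{1+v+v^2}$, and with it $$\Phi(z,1)=\frac{1+v+v^2}{1+v},\qquad \frac{\partial \Phi}{\partial t}(z,t)\Big|_{t=1}=\frac{v^2}{(1-v)(1+v)^2(1+v+v^2)}.$$ As $n\to\infty$, $$s_n\sim\frac{\sqrt3}{36}\,\frac{3^n}{\sqrt{\pi n}},\qquad d_n\sim\frac{3\sqrt3}{8}\,\frac{3^n}{\sqrt{\pi}\,n^{3/2}},$$ and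 consequently the average number of up-runs of length one in a closed Deutsch path of length $n$ satisfies $$\frac{s_n}{d_n}\sim\frac{2n}{27}\qquad\Bigl(\tfrac{2}{27}=0.074\ldots\Bigr).$$ -/

import Mathlib

/-- A closed Deutsch path, given by the list of the vertical increments of its steps
`(1, s)`: each step is an up-step `(1, 1)` or a down-step `(1, -j)` with `j ≥ 1`, the path
starts at the origin, never goes below the `x`-axis, and ends on the `x`-axis. -/
structure IsClosedDeutschPath (p : List ℤ) : Prop where
  steps : ∀ s ∈ p, s = 1 ∨ ∃ j : ℕ, 1 ≤ j ∧ s = -(j : ℤ)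
  nonneg : ∀ k ≤ p.length, 0 ≤ (p.take k).sum
  closed : p.sum = 0

/-- The steps at the positions `a, a + 1, …, b - 1` of `p` form a maximal up-run: they are all
up-steps, and the steps just before and just after them, if present, are not up-steps. -/
def IsUpRun (p : List ℤ) (a b : ℕ) : Prop :=
  a < b ∧ (∀ i ∈ Finset.Ico a b, p[i]? = some 1) ∧
    (a = 0 ∨ p[a - 1]? ≠ some 1) ∧ p[b]? ≠ some 1

instance (p : List ℤ) (a b : ℕ) : Decidable (IsUpRun p a b) := by
  unfold IsUpRun
  infer_instance

/-- The number of maximal up-runs of length exactly one. -/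
def singleUpRuns (p : List ℤ) : ℕ :=
  ((Finset.range p.length).filter fun a => IsUpRun p a (a + 1)).card

theorem finite_closedDeutschPaths (n : ℕ) :
    {p : List ℤ | IsClosedDeutschPath p ∧ p.length = n}.Finite := by
  refine ((List.finite_length_eq (Set.Icc (-(n : ℤ)) 1) n).image
    (List.map Subtype.val)).subset ?_
  rintro p ⟨hp, hn⟩
  have hle : ∀ s ∈ p, s ≤ 1 := by
    intro s hs
    rcases hp.steps s hs with h | ⟨j, hj, h⟩ <;> omega
  have hmem : ∀ s ∈ p, s ∈ Set.Icc (-(n : ℤ)) 1 := by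
    intro s hs
    refine ⟨?_, hle s hs⟩
    obtain ⟨k, hk, rfl⟩ := List.mem_iff_getElem.1 hs
    have h1 := hp.nonneg (k + 1) hk
    rw [List.sum_take_succ p k hk] at h1
    have h2 : (p.take k).sum ≤ (p.take k).length • (1 : ℤ) :=
      List.sum_le_card_nsmul _ _ fun x hx => hle x (List.mem_of_mem_take hx)
    have h3 : (p.take k).length ≤ n := by
      rw [← hn]
      exact List.length_take_le' k p
    simp only [nsmul_eq_mul, mul_one] at h2
    omega
  refine ⟨p.attach.map fun s => ⟨s.1, hmem s.1 s.2⟩, ?_, ?_⟩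
  · simpa using hn
  · simp

/-- The closed Deutsch paths of length `n` (that is, with `n` steps). -/
noncomputable def closedDeutschPaths (n : ℕ) : Finset (List ℤ) :=
  (finite_closedDeutschPaths n).toFinset

/-- The number of closed Deutsch paths of length `n`. -/
noncomputable def deutschCount (n : ℕ) : ℕ := (closedDeutschPaths n).card

/-- The total number of maximal up-runs of length one in all closed Deutsch paths of length `n`. -/
noncomputable def totalSingleUpRuns (n : ℕ) : ℕ :=
  ∑ p ∈ closedDeutschPaths n, singleUpRuns p

/-- The average number of maximal up-runs of length one in a closed Deutsch path of length `n`
(there is at least one such path for every `n ≠ 1`). -/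
noncomputable def averageSingleUpRuns (n : ℕ) : ℝ :=
  (totalSingleUpRuns n : ℝ) / (deutschCount n : ℝ)

/-- The bivariate generating function of closed Deutsch paths, as a power series in `z` (marking
the length) whose coefficients are polynomials in `t` (marking the up-runs of length one). -/
noncomputable def deutschSeries : PowerSeries (Polynomial ℝ) :=
  PowerSeries.mk fun n => ∑ p ∈ closedDeutschPaths n, Polynomial.X ^ singleUpRuns p

/-- The value at `t = 1` of a power series in `z` with coefficients polynomial in `t`. -/
noncomputable def evalAtOne (F : PowerSeries (Polynomial ℝ)) : PowerSeries ℝ :=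
  PowerSeries.mk fun n => (PowerSeries.coeff n F).eval 1

/-- The (coefficientwise) `t`-derivative of a power series in `z` with coefficients
polynomial in `t`. -/
noncomputable def derivT (F : PowerSeries (Polynomial ℝ)) : PowerSeries (Polynomial ℝ) :=
  PowerSeries.mk fun n => Polynomial.derivative (PowerSeries.coeff n F)

/-! Cut a path after an initial segment: the rest is a completion from some height h to 0, and the
past affects its weight in t only through the pending up-run, which is empty, of length one, or of
length at least two. The three families of generating functions satisfy a linear system whose
right-hand sides carry a factor z in front of every unknown, so a power series solution is unique.
That solution is geometric in h: if U = 1 + z + z²tU + z³U²V with V = 1/(1 - zU), the completions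
with nothing pending have series (U - 1)U^h/(1 + z) for h ≥ 1, and Φ = U/(1 + z)
(`X_pow_dvd_prefixedSeries_sub`).

At t = 1 one has U = 1 + v. The derivative in t is read off by working at t = 1 + ε over the dual
numbers, where U = 1 + v + εz²/(1 - v) (`deutsch_gf_of_kernel`).

The asymptotics use integrals instead of singularity analysis. With T(n,k) the k-th Fourier
coefficient of (1 + 2 cos θ)^n, comparing series in v gives d_n = T(n,0) - T(n,1) and s_{n+2} =
(T(n,0) + (-1)^n)/2. Substituting θ = x/√n, dominated convergence leaves the Gaussian integrals of
e^(-x²/3) and e^(-x²/3)x²/2; the factor 1 - cos θ in d_n costs an extra 1/n. -/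

/-! ### Effect of the first steps on the number of single up-runs -/

/-- A single up-run at position `a`, spelled out. -/
theorem isUpRun_succ_iff (p : List ℤ) (a : ℕ) :
    IsUpRun p a (a + 1) ↔
      p[a]? = some 1 ∧ (a = 0 ∨ p[a - 1]? ≠ some 1) ∧ p[a + 1]? ≠ some 1 := by
  simp [IsUpRun]

theorem singleUpRuns_cons (x : ℤ) (p : List ℤ) :
    singleUpRuns (x :: p) =
      (∑ a ∈ Finset.range p.length, if IsUpRun (x :: p) (a + 1) (a + 2) then 1 else 0) +
        if IsUpRun (x :: p) 0 1 then 1 else 0 := by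
  rw [singleUpRuns, Finset.card_filter, List.length_cons, Finset.sum_range_succ']

theorem singleUpRuns_eq_sum (p : List ℤ) :
    singleUpRuns p = ∑ a ∈ Finset.range p.length, if IsUpRun p a (a + 1) then 1 else 0 := by
  rw [singleUpRuns, Finset.card_filter]

theorem singleUpRuns_nil : singleUpRuns [] = 0 := by
  simp [singleUpRuns]

theorem singleUpRuns_cons_of_ne {x : ℤ} (hx : x ≠ 1) (p : List ℤ) :
    singleUpRuns (x :: p) = singleUpRuns p := by
  have h0 : ¬ IsUpRun (x :: p) 0 1 := by
    rw [isUpRun_succ_iff]; simp [hx]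
  rw [singleUpRuns_cons, singleUpRuns_eq_sum p, if_neg h0, add_zero]
  refine Finset.sum_congr rfl fun a _ => if_congr ?_ rfl rfl
  rw [isUpRun_succ_iff, isUpRun_succ_iff]
  cases a <;> simp [hx]

theorem isUpRun_cons_cons_succ (x y : ℤ) (p : List ℤ) (a : ℕ) :
    IsUpRun (x :: y :: p) (a + 2) (a + 3) ↔ IsUpRun (y :: p) (a + 1) (a + 2) := by
  rw [isUpRun_succ_iff, isUpRun_succ_iff]
  simp

theorem singleUpRuns_one_cons_of_ne {x : ℤ} (hx : x ≠ 1) (p : List ℤ) :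
    singleUpRuns (1 :: x :: p) = singleUpRuns p + 1 := by
  have h0 : IsUpRun (1 :: x :: p) 0 1 := by
    rw [isUpRun_succ_iff]; simp [hx]
  have h1 : ¬ IsUpRun (1 :: x :: p) 1 2 := by
    rw [isUpRun_succ_iff]; simp [hx]
  have h2 : ¬ IsUpRun (x :: p) 0 1 := by
    rw [isUpRun_succ_iff]; simp [hx]
  rw [← singleUpRuns_cons_of_ne hx p, singleUpRuns_cons, if_pos h0, singleUpRuns_cons x p,
    if_neg h2, List.length_cons, Finset.sum_range_succ', zero_add, if_neg h1]
  simp only [isUpRun_cons_cons_succ]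

/-- An initial run of length at least two never counts, so its exact length can be forgotten: the
prefix `[1, 1]` stands for all of them. -/
theorem singleUpRuns_one_one_one_cons (p : List ℤ) :
    singleUpRuns (1 :: 1 :: 1 :: p) = singleUpRuns (1 :: 1 :: p) := by
  have h0 : ∀ q : List ℤ, ¬ IsUpRun (1 :: 1 :: q) 0 1 := by
    intro q; rw [isUpRun_succ_iff]; simp
  have h1 : ¬ IsUpRun (1 :: 1 :: 1 :: p) 1 2 := by
    rw [isUpRun_succ_iff]; simp
  rw [singleUpRuns_cons, singleUpRuns_cons 1 (1 :: p), if_neg (h0 _), if_neg (h0 _),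
    List.length_cons, Finset.sum_range_succ', zero_add, if_neg h1]
  simp only [isUpRun_cons_cons_succ]

theorem singleUpRuns_one_one_cons_of_ne {x : ℤ} (hx : x ≠ 1) (p : List ℤ) :
    singleUpRuns (1 :: 1 :: x :: p) = singleUpRuns p := by
  have h0 : ¬ IsUpRun (1 :: 1 :: x :: p) 0 1 := by
    rw [isUpRun_succ_iff]; simp
  have h1 : ¬ IsUpRun (1 :: 1 :: x :: p) 1 2 := by
    rw [isUpRun_succ_iff]; simp
  have h2 : ¬ IsUpRun (1 :: x :: p) 1 2 := by
    rw [isUpRun_succ_iff]; simp [hx]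
  have h3 : ¬ IsUpRun (x :: p) 0 1 := by
    rw [isUpRun_succ_iff]; simp [hx]
  rw [← singleUpRuns_cons_of_ne hx p, singleUpRuns_cons, singleUpRuns_cons x p, if_neg h0,
    if_neg h3, List.length_cons, Finset.sum_range_succ', zero_add, if_neg h1,
    List.length_cons, Finset.sum_range_succ', zero_add]
  simp only [isUpRun_cons_cons_succ, if_neg h2]

/-! ### Completions from a given height -/

/-- The lists of `n` Deutsch steps that lead from height `h` to height `0` without going below
height `0`. -/
def deutschCompletions : ℕ → ℕ → Finset (List ℤ)
  | 0, h => if h = 0 then {[]} else ∅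
  | n + 1, h => (deutschCompletions n (h + 1)).image (List.cons 1) ∪
      (Finset.range h).biUnion fun k =>
        (deutschCompletions n k).image (List.cons ((k : ℤ) - h))

theorem mem_deutschCompletions (n h : ℕ) (p : List ℤ) :
    p ∈ deutschCompletions n h ↔ p.length = n ∧
      (∀ s ∈ p, s = 1 ∨ ∃ j : ℕ, 1 ≤ j ∧ s = -(j : ℤ)) ∧
      (∀ k ≤ p.length, 0 ≤ (h : ℤ) + (p.take k).sum) ∧ (h : ℤ) + p.sum = 0 := by
  induction n generalizing h p with
  | zero =>
    by_cases hh : h = 0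
    · subst hh
      simp only [deutschCompletions, if_true, Finset.mem_singleton]
      constructor
      · rintro rfl; simp
      · intro hp; exact List.length_eq_zero_iff.1 hp.1
    · simp only [deutschCompletions, if_neg hh]
      constructor
      · intro hp; simp at hp
      · rintro ⟨hl, -, -, hs⟩
        rw [List.length_eq_zero_iff.1 hl] at hs
        simp at hs
        exact absurd hs hh
  | succ n ih =>
    simp only [deutschCompletions, Finset.mem_union, Finset.mem_image, Finset.mem_biUnion,
      Finset.mem_range, ih]
    constructor
    · rintro (⟨q, ⟨hl, hs, hn, hc⟩, rfl⟩ | ⟨k, hk, q, ⟨hl, hs, hn, hc⟩, rfl⟩)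
      · refine ⟨by simp [hl], ?_, ?_, ?_⟩
        · intro s hs'
          rcases List.mem_cons.1 hs' with rfl | h'
          · exact Or.inl rfl
          · exact hs s h'
        · intro k hk
          cases k with
          | zero => simp
          | succ k =>
            have := hn k (by simpa using hk)
            simp only [List.take_succ_cons, List.sum_cons]
            push_cast at this
            linarith
        · rw [List.sum_cons]; push_cast at hc; linarith
      · refine ⟨by simp [hl], ?_, ?_, ?_⟩
        · intro s hs'
          rcases List.mem_cons.1 hs' with rfl | h'
          · exact Or.inr ⟨h - k, by omega, by omega⟩
          · exact hs s h'
        · intro i hi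
          cases i with
          | zero => simp
          | succ i =>
            have := hn i (by simpa using hi)
            simp only [List.take_succ_cons, List.sum_cons]
            linarith
        · rw [List.sum_cons]; linarith
    · rintro ⟨hl, hs, hn, hc⟩
      cases p with
      | nil => simp at hl
      | cons x q =>
        have hl' : q.length = n := by simpa using hl
        have hs' : ∀ s ∈ q, s = 1 ∨ ∃ j : ℕ, 1 ≤ j ∧ s = -(j : ℤ) := fun s h' =>
          hs s (List.mem_cons_of_mem _ h')
        have hn' : ∀ k ≤ q.length, 0 ≤ ((h : ℤ) + x) + (q.take k).sum := by
          intro k hk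
          have := hn (k + 1) (by simpa using hk)
          simp only [List.take_succ_cons, List.sum_cons] at this
          linarith
        rw [List.sum_cons] at hc
        rcases hs x List.mem_cons_self with rfl | ⟨j, hj, rfl⟩
        · refine Or.inl ⟨q, ⟨hl', hs', ?_, ?_⟩, rfl⟩
          · push_cast; exact hn'
          · push_cast; linarith
        · have hjh : j ≤ h := by
            have := hn' 0 (Nat.zero_le _)
            simp at this
            omega
          refine Or.inr ⟨h - j, by omega, q, ⟨hl', hs', ?_, ?_⟩, ?_⟩
          · push_cast [Nat.cast_sub hjh]; exact hn'
          · push_cast [Nat.cast_sub hjh]; linarith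
          · push_cast [Nat.cast_sub hjh]; ring_nf

theorem closedDeutschPaths_eq (n : ℕ) : closedDeutschPaths n = deutschCompletions n 0 := by
  ext p
  rw [mem_deutschCompletions, closedDeutschPaths, Set.Finite.mem_toFinset, Set.mem_ofPred_eq]
  simp only [Nat.cast_zero, zero_add]
  exact ⟨fun ⟨⟨a, b, c⟩, d⟩ => ⟨d, a, b, c⟩, fun ⟨d, a, b, c⟩ => ⟨⟨a, b, c⟩, d⟩⟩

theorem sum_deutschCompletions_zero {M : Type*} [AddCommMonoid M] (h : ℕ) (f : List ℤ → M) :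
    ∑ p ∈ deutschCompletions 0 h, f p = if h = 0 then f [] else 0 := by
  simp only [deutschCompletions]
  split_ifs <;> simp

theorem sum_deutschCompletions_succ {M : Type*} [AddCommMonoid M] (n h : ℕ) (f : List ℤ → M) :
    ∑ p ∈ deutschCompletions (n + 1) h, f p =
      ∑ p ∈ deutschCompletions n (h + 1), f (1 :: p) +
        ∑ k ∈ Finset.range h, ∑ p ∈ deutschCompletions n k, f (((k : ℤ) - h) :: p) := by
  rw [deutschCompletions, Finset.sum_union, Finset.sum_image, Finset.sum_biUnion]
  · congr 1
    refine Finset.sum_congr rfl fun k _ => ?_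
    rw [Finset.sum_image]
    exact fun a _ b _ hab => List.cons_injective hab
  · intro i _ j _ hij
    rw [Function.onFun, Finset.disjoint_left]
    intro p hp hq
    obtain ⟨a, _, rfl⟩ := Finset.mem_image.1 hp
    obtain ⟨b, _, hb⟩ := Finset.mem_image.1 hq
    have := (List.cons.inj hb).1
    omega
  · exact fun a _ b _ hab => List.cons_injective hab
  · rw [Finset.disjoint_left]
    intro p hp hq
    obtain ⟨a, _, rfl⟩ := Finset.mem_image.1 hp
    obtain ⟨k, hk, hq⟩ := Finset.mem_biUnion.1 hq
    obtain ⟨b, _, hb⟩ := Finset.mem_image.1 hq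
    have := (List.cons.inj hb).1
    have := Finset.mem_range.1 hk
    omega

theorem PowerSeries.eq_zero_of_forall_X_pow_dvd {R : Type*} [CommRing R] {f : PowerSeries R}
    (h : ∀ n : ℕ, PowerSeries.X ^ n ∣ f) : f = 0 := by
  ext n
  rw [PowerSeries.X_pow_dvd_iff.1 (h (n + 1)) n n.lt_succ_self, map_zero]

/-! ### The linear system for the three prefixes and its solution -/

section Completions

variable {K : Type*} [CommRing K]

/-- The generating function of the completions from height `h`, weighted by `f`. -/
noncomputable def completionSeries (f : List ℤ → K) (h : ℕ) : PowerSeries K :=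
  PowerSeries.mk fun n => ∑ p ∈ deutschCompletions n h, f p

theorem completionSeries_eq (f : List ℤ → K) (h : ℕ) :
    completionSeries f h = PowerSeries.C (if h = 0 then f [] else 0) +
      PowerSeries.X * (completionSeries (fun p => f (1 :: p)) (h + 1) +
        ∑ k ∈ Finset.range h, completionSeries (fun p => f (((k : ℤ) - h) :: p)) k) := by
  ext n
  cases n with
  | zero => simp [completionSeries, sum_deutschCompletions_zero]
  | succ n =>
    simp [completionSeries, sum_deutschCompletions_succ, PowerSeries.coeff_succ_X_mul,
      PowerSeries.coeff_succ_C]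

/-- The completions weighted by `t ^ (number of single up-runs)`, preceded by a list `l`. -/
noncomputable def prefixedSeries (t : K) (l : List ℤ) (h : ℕ) : PowerSeries K :=
  completionSeries (fun p => t ^ singleUpRuns (l ++ p)) h

theorem sub_ne_one_of_mem_range {h k : ℕ} (hk : k ∈ Finset.range h) : (k : ℤ) - h ≠ 1 := by
  have := Finset.mem_range.1 hk
  omega

/-- The prefixes `[]`, `[1]`, `[1, 1]` are the three states of the pending up-run. The two states
after an up-step are used only at positive height, so the empty completion contributes to `[]`
alone. -/
theorem prefixedSeries_nil_eq (t : K) (h : ℕ) :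
    prefixedSeries t [] h = (if h = 0 then 1 else 0) + PowerSeries.X *
      (prefixedSeries t [1] (h + 1) + ∑ k ∈ Finset.range h, prefixedSeries t [] k) := by
  rw [prefixedSeries, completionSeries_eq]
  congr 1
  · split_ifs <;> simp [singleUpRuns_nil]
  · congr 2
    refine Finset.sum_congr rfl fun k hk => ?_
    simp only [prefixedSeries, List.nil_append,
      singleUpRuns_cons_of_ne (sub_ne_one_of_mem_range hk)]

theorem prefixedSeries_one_one_succ (t : K) (h : ℕ) :
    prefixedSeries t [1, 1] (h + 1) = PowerSeries.X *
      (prefixedSeries t [1, 1] (h + 2) + ∑ k ∈ Finset.range (h + 1), prefixedSeries t [] k) := by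
  rw [prefixedSeries, completionSeries_eq, if_neg (Nat.succ_ne_zero h), map_zero, zero_add]
  congr 2
  · simp only [prefixedSeries, List.cons_append, List.nil_append, singleUpRuns_one_one_one_cons]
  · refine Finset.sum_congr rfl fun k hk => ?_
    simp only [prefixedSeries, List.nil_append, List.cons_append,
      singleUpRuns_one_one_cons_of_ne (sub_ne_one_of_mem_range hk)]

theorem prefixedSeries_one_succ (t : K) (h : ℕ) :
    prefixedSeries t [1] (h + 1) = PowerSeries.X *
      (prefixedSeries t [1, 1] (h + 2) +
        ∑ k ∈ Finset.range (h + 1), PowerSeries.C t * prefixedSeries t [] k) := by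
  rw [prefixedSeries, completionSeries_eq, if_neg (Nat.succ_ne_zero h), map_zero, zero_add]
  congr 2
  refine Finset.sum_congr rfl fun k hk => ?_
  simp only [prefixedSeries, List.nil_append, List.cons_append,
    singleUpRuns_one_cons_of_ne (sub_ne_one_of_mem_range hk)]
  ext n
  simp [completionSeries, pow_succ', Finset.mul_sum]

/-- The series `(1 + z) D_h`, where `D_h` counts the completions from height `h` after a
down-step, in terms of the solution `U` of the kernel equation. -/
noncomputable def kernelTerm (U : PowerSeries K) (h : ℕ) : PowerSeries K :=
  if h = 0 then U else (U - 1) * U ^ h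

/-- (U - 1)U^k = U^(k+1) - U^k telescopes, and the exceptional value U at k = 0 supplies the initial
term. Thus the sum over all down-steps is a single power of U. -/
theorem sum_kernelTerm (U : PowerSeries K) (h : ℕ) :
    ∑ k ∈ Finset.range (h + 1), kernelTerm U k = U ^ (h + 1) := by
  induction h with
  | zero => simp [kernelTerm]
  | succ h ih =>
    rw [Finset.sum_range_succ, ih, kernelTerm, if_neg (Nat.succ_ne_zero h)]
    ring

/-- The proposed solution and the true series satisfy the same system. Subtracting, each error is z
times a combination of errors, so divisibility by z^n improves to z^(n+1). -/
theorem X_pow_dvd_prefixedSeries_sub (t : K) (U V : PowerSeries K)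
    (hU : U = 1 + PowerSeries.X + PowerSeries.X ^ 2 * PowerSeries.C t * U +
      PowerSeries.X ^ 3 * U ^ 2 * V)
    (hV : V * (1 - PowerSeries.X * U) = 1) (n : ℕ) :
    (∀ h, PowerSeries.X ^ n ∣ (1 + PowerSeries.X) * prefixedSeries t [] h - kernelTerm U h) ∧
    (∀ h, PowerSeries.X ^ n ∣ (1 + PowerSeries.X) * prefixedSeries t [1, 1] (h + 1) -
      PowerSeries.X * U ^ (h + 1) * V) ∧
    (∀ h, PowerSeries.X ^ n ∣ (1 + PowerSeries.X) * prefixedSeries t [1] (h + 1) -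
      PowerSeries.X * U ^ (h + 1) * (PowerSeries.C t - 1 + V)) := by
  induction n with
  | zero => simp
  | succ n ih =>
    obtain ⟨ihD, ihB, ihA⟩ := ih
    have hsum : ∀ h, PowerSeries.X ^ n ∣
        (1 + PowerSeries.X) * ∑ k ∈ Finset.range (h + 1), prefixedSeries t [] k -
          U ^ (h + 1) := fun h => by
      rw [← sum_kernelTerm U h, Finset.mul_sum, ← Finset.sum_sub_distrib]
      exact Finset.dvd_sum fun k _ => ihD k
    refine ⟨fun h => ?_, fun h => ?_, fun h => ?_⟩
    · rw [pow_succ', prefixedSeries_nil_eq]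
      cases h with
      | zero =>
        convert! mul_dvd_mul_left PowerSeries.X (ihA 0) using 1
        simp only [kernelTerm, if_true, Finset.range_zero, Finset.sum_empty]
        -- Since V - 1 = zUV, the equation at height 0 is exactly the equation of U; at positive
        -- height it is the same one times a power of U.
        linear_combination -hU + PowerSeries.X ^ 2 * U * hV
      | succ h =>
        convert! mul_dvd_mul_left PowerSeries.X (dvd_add (ihA (h + 1)) (hsum h)) using 1
        simp only [kernelTerm, if_neg (Nat.succ_ne_zero h)]
        linear_combination -U ^ (h + 1) * hU + PowerSeries.X ^ 2 * U ^ (h + 2) * hV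
    · rw [pow_succ', prefixedSeries_one_one_succ]
      convert! mul_dvd_mul_left PowerSeries.X (dvd_add (ihB (h + 1)) (hsum h)) using 1
      linear_combination -PowerSeries.X * U ^ (h + 1) * hV
    · rw [pow_succ', prefixedSeries_one_succ, ← Finset.mul_sum]
      convert! mul_dvd_mul_left PowerSeries.X
        (dvd_add (ihB (h + 1)) (Dvd.dvd.mul_left (hsum h) (PowerSeries.C t))) using 1
      linear_combination -PowerSeries.X * U ^ (h + 1) * hV

theorem one_add_X_mul_deutsch_eq (t : K) (U V : PowerSeries K)
    (hU : U = 1 + PowerSeries.X + PowerSeries.X ^ 2 * PowerSeries.C t * U +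
      PowerSeries.X ^ 3 * U ^ 2 * V)
    (hV : V * (1 - PowerSeries.X * U) = 1) :
    (1 + PowerSeries.X) *
      PowerSeries.mk (fun n => ∑ p ∈ closedDeutschPaths n, t ^ singleUpRuns p) = U := by
  have h := PowerSeries.eq_zero_of_forall_X_pow_dvd fun n =>
    (X_pow_dvd_prefixedSeries_sub t U V hU hV n).1 0
  rw [sub_eq_zero] at h
  simpa only [prefixedSeries, completionSeries, kernelTerm, if_true, List.nil_append,
    ← closedDeutschPaths_eq] using h

end Completions

/-! ### Value and t-derivative at t = 1 through dual numbers -/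

theorem evalAtOne_deutschSeries :
    evalAtOne deutschSeries = PowerSeries.mk fun n => (deutschCount n : ℝ) := by
  ext n
  simp [evalAtOne, deutschSeries, deutschCount, Polynomial.eval_finsetSum]

theorem evalAtOne_derivT_deutschSeries :
    evalAtOne (derivT deutschSeries) = PowerSeries.mk fun n => (totalSingleUpRuns n : ℝ) := by
  ext n
  simp [evalAtOne, derivT, deutschSeries, totalSingleUpRuns, Polynomial.eval_finsetSum,
    Polynomial.derivative_X_pow]

theorem DualNumber.one_add_eps_pow (k : ℕ) :
    (1 + DualNumber.eps : DualNumber ℝ) ^ k = 1 + (k : DualNumber ℝ) * DualNumber.eps := by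
  induction k with
  | zero => simp
  | succ k ih =>
    rw [pow_succ, ih]
    push_cast
    linear_combination (k : DualNumber ℝ) * DualNumber.eps_mul_eps (R := ℝ)

theorem dualNumber_map_injective {a b : PowerSeries ℝ}
    (h : PowerSeries.map (algebraMap ℝ (DualNumber ℝ)) a +
      PowerSeries.C DualNumber.eps * PowerSeries.map (algebraMap ℝ (DualNumber ℝ)) b = 0) :
    a = 0 ∧ b = 0 := by
  have h' := fun n => congrArg (PowerSeries.coeff n) h
  simp only [map_add, PowerSeries.coeff_map, PowerSeries.coeff_C_mul, map_zero] at h'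
  constructor
  · ext n
    simpa [TrivSqZeroExt.algebraMap_eq_inl] using congrArg TrivSqZeroExt.fst (h' n)
  · ext n
    simpa [TrivSqZeroExt.algebraMap_eq_inl] using congrArg TrivSqZeroExt.snd (h' n)

/-- If `v = z (1 + v + v²)`, both generating functions at `t = 1`. -/
theorem deutsch_gf_of_kernel (v w V : PowerSeries ℝ)
    (hv : v = PowerSeries.X * (1 + v + v ^ 2))
    (hV : V * (1 - PowerSeries.X * (1 + v)) = 1)
    (hw : w * (1 - v) = PowerSeries.X ^ 2) :
    (1 + PowerSeries.X) * (PowerSeries.mk fun n => (deutschCount n : ℝ)) = 1 + v ∧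
    (1 + PowerSeries.X) * (PowerSeries.mk fun n => (totalSingleUpRuns n : ℝ)) = w := by
  have hVv : V = 1 + v + v ^ 2 := by
    have h1 : (1 - PowerSeries.X * (1 + v)) * (1 + v + v ^ 2) = 1 := by
      linear_combination (1 + v) * hv
    linear_combination (1 + v + v ^ 2) * hV - V * h1
  let ι := PowerSeries.map (algebraMap ℝ (DualNumber ℝ))
  let e : PowerSeries (DualNumber ℝ) := PowerSeries.C DualNumber.eps
  have he : e * e = 0 := by
    rw [← map_mul, DualNumber.eps_mul_eps, map_zero]
  have hX : ι PowerSeries.X = PowerSeries.X := PowerSeries.map_X _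
  have hvι : ι v = PowerSeries.X * (1 + ι v + ι v ^ 2) := by
    conv_lhs => rw [hv]
    simp [hX]
  have hVι : ι V = 1 + ι v + ι v ^ 2 := by
    rw [hVv]; simp
  have hwι : ι w * (1 - ι v) = PowerSeries.X ^ 2 := by
    have := congrArg ι hw
    simpa [hX] using this
  have hVι' : ι V * (1 - PowerSeries.X * (1 + ι v)) = 1 := by
    have := congrArg ι hV
    simpa [hX] using this
  -- First-order expansions in ε: w is the t-derivative of U at t = 1, and zwV² is the resulting
  -- derivative of V = 1/(1 - zU).
  have key := one_add_X_mul_deutsch_eq (1 + DualNumber.eps) (ι (1 + v) + e * ι w)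
    (ι V + e * (PowerSeries.X * ι w * ι V ^ 2)) ?_ ?_
  · have hmk : PowerSeries.mk (fun n => ∑ p ∈ closedDeutschPaths n,
          (1 + DualNumber.eps : DualNumber ℝ) ^ singleUpRuns p) =
        ι (PowerSeries.mk fun n => (deutschCount n : ℝ)) +
          e * ι (PowerSeries.mk fun n => (totalSingleUpRuns n : ℝ)) := by
      ext n : 1
      simp only [ι, e, PowerSeries.coeff_mk, map_add, PowerSeries.coeff_map,
        PowerSeries.coeff_C_mul, map_natCast, DualNumber.one_add_eps_pow,
        Finset.sum_add_distrib, Finset.sum_const, nsmul_eq_mul, mul_one, ← Finset.sum_mul,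
        ← Nat.cast_sum, deutschCount, totalSingleUpRuns]
      ring
    rw [hmk] at key
    have h0 := dualNumber_map_injective
      (a := (1 + PowerSeries.X) * (PowerSeries.mk fun n => (deutschCount n : ℝ)) - (1 + v))
      (b := (1 + PowerSeries.X) * (PowerSeries.mk fun n => (totalSingleUpRuns n : ℝ)) - w) (by
        change ι _ + e * ι _ = 0
        simp only [map_sub, map_mul, map_add, map_one, hX] at key ⊢
        linear_combination key)
    exact ⟨sub_eq_zero.1 h0.1, sub_eq_zero.1 h0.2⟩
  · have hC : PowerSeries.C (1 + DualNumber.eps : DualNumber ℝ) = 1 + e := by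
      rw [map_add, map_one]
    rw [hC, hVι, map_add, map_one]
    generalize ι v = a at *
    generalize ι w = b at *
    generalize (PowerSeries.X : PowerSeries (DualNumber ℝ)) = x at *
    obtain ⟨c, hc⟩ : ∃ c, c = 1 + a + a ^ 2 := ⟨_, rfl⟩
    rw [← hc] at hvι ⊢
    linear_combination (1 + x * (1 + a) + x ^ 2 * (1 + a) ^ 2) * hvι +
      x * (x * (1 + a) + 1) * hc + e * ((1 + a) * hwι +
        (b * (a + x * c) + x ^ 2 * b * (1 + a) * (2 * c - (1 + a) * (a - x * c))) * hvι +
        x ^ 2 * b * (c + 1 + a + a ^ 2 - 2 * (1 + a) * (a - x * c)) * hc) -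
      (x ^ 2 * b + x ^ 3 * (b ^ 2 * c + 2 * (1 + a) * x * b ^ 2 * c ^ 2) +
        x ^ 4 * b ^ 3 * c ^ 2 * e) * he
  · rw [map_add, map_one]
    linear_combination (1 + e * PowerSeries.X * ι w * ι V) * hVι' -
      PowerSeries.X ^ 2 * ι w ^ 2 * ι V ^ 2 * he

/-! ### The series v and the closed forms -/

/-- The coefficients of the solution `v` of `v = z (1 + v + v²)`. -/
noncomputable def kernelCoeff : ℕ → ℝ
  | 0 => 0
  | n + 1 => (if n = 0 then 1 else 0) + kernelCoeff n +
      ∑ i : Fin (n + 1), kernelCoeff i * kernelCoeff (n - i)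

theorem mk_kernelCoeff_eq :
    PowerSeries.mk kernelCoeff = PowerSeries.X *
      (1 + PowerSeries.mk kernelCoeff + PowerSeries.mk kernelCoeff ^ 2) := by
  ext n
  cases n with
  | zero => simp [kernelCoeff]
  | succ n =>
    rw [PowerSeries.coeff_succ_X_mul, PowerSeries.coeff_mk, kernelCoeff, map_add, map_add,
      PowerSeries.coeff_one, PowerSeries.coeff_mk, sq, PowerSeries.coeff_mul,
      Finset.Nat.sum_antidiagonal_eq_sum_range_succ_mk, Finset.sum_range]
    simp only [PowerSeries.coeff_mk]

theorem kernel_unique {v w : PowerSeries ℝ} (hv : v = PowerSeries.X * (1 + v + v ^ 2))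
    (hw : w = PowerSeries.X * (1 + w + w ^ 2)) : v = w := by
  have h : (v - w) * (1 - PowerSeries.X * (1 + v + w)) = 0 := by
    linear_combination hv - hw
  rcases mul_eq_zero.1 h with h | h
  · exact sub_eq_zero.1 h
  · simpa using congrArg PowerSeries.constantCoeff h

theorem constantCoeff_of_kernel {v : PowerSeries ℝ}
    (hv : v = PowerSeries.X * (1 + v + v ^ 2)) : PowerSeries.constantCoeff v = 0 := by
  rw [hv]; simp

/-- The inverse is genuine for every real v: its constant term c satisfies 1 + c + c² = (c + 1/2)² +
3/4 > 0. -/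
theorem X_eq_mul_inv_iff (v : PowerSeries ℝ) :
    PowerSeries.X = v * (1 + v + v ^ 2)⁻¹ ↔ v = PowerSeries.X * (1 + v + v ^ 2) := by
  rw [PowerSeries.eq_mul_inv_iff_mul_eq, eq_comm]
  simp only [map_add, map_one, map_pow]
  nlinarith [sq_nonneg (PowerSeries.constantCoeff v + 1 / 2)]

theorem existsUnique_kernel :
    ∃! v : PowerSeries ℝ, PowerSeries.X = v * (1 + v + v ^ 2)⁻¹ :=
  ⟨_, (X_eq_mul_inv_iff _).2 mk_kernelCoeff_eq, fun _ hw =>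
    kernel_unique ((X_eq_mul_inv_iff _).1 hw) mk_kernelCoeff_eq⟩

theorem deutsch_gf_mul {v : PowerSeries ℝ} (hv : v = PowerSeries.X * (1 + v + v ^ 2)) :
    (1 + PowerSeries.X) * (PowerSeries.mk fun n => (deutschCount n : ℝ)) = 1 + v ∧
    (1 + PowerSeries.X) * (PowerSeries.mk fun n => (totalSingleUpRuns n : ℝ)) * (1 - v) =
      PowerSeries.X ^ 2 := by
  have hc := constantCoeff_of_kernel hv
  have hV : (1 - PowerSeries.X * (1 + v))⁻¹ * (1 - PowerSeries.X * (1 + v)) = 1 :=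
    PowerSeries.inv_mul_cancel _ (by simp)
  have hw : PowerSeries.X ^ 2 * (1 - v)⁻¹ * (1 - v) = PowerSeries.X ^ 2 := by
    rw [mul_assoc, PowerSeries.inv_mul_cancel _ (by simp [hc]), mul_one]
  obtain ⟨h1, h2⟩ := deutsch_gf_of_kernel v _ _ hv hV hw
  exact ⟨h1, by rw [h2, hw]⟩

theorem one_add_ne_zero_of_kernel {v : PowerSeries ℝ}
    (hv : v = PowerSeries.X * (1 + v + v ^ 2)) : 1 + v ≠ 0 := fun h => by
  simpa [constantCoeff_of_kernel hv] using congrArg PowerSeries.constantCoeff h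

/-- The factor 1 + z is eliminated by (1 + z)(1 + v + v²) = (1 + v)². -/
theorem deutschCount_gf_mul {v : PowerSeries ℝ} (hv : v = PowerSeries.X * (1 + v + v ^ 2)) :
    (PowerSeries.mk fun n => (deutschCount n : ℝ)) * (1 + v) = 1 + v + v ^ 2 := by
  apply mul_right_cancel₀ (one_add_ne_zero_of_kernel hv)
  linear_combination (1 + v + v ^ 2) * (deutsch_gf_mul hv).1 +
    (PowerSeries.mk fun n => (deutschCount n : ℝ)) * hv

theorem evalAtOne_deutschSeries_eq {v : PowerSeries ℝ}
    (hv : v = PowerSeries.X * (1 + v + v ^ 2)) :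
    evalAtOne deutschSeries = (1 + v + v ^ 2) * (1 + v)⁻¹ := by
  rw [PowerSeries.eq_mul_inv_iff_mul_eq (by simp [constantCoeff_of_kernel hv]),
    evalAtOne_deutschSeries, deutschCount_gf_mul hv]

theorem evalAtOne_derivT_deutschSeries_eq {v : PowerSeries ℝ}
    (hv : v = PowerSeries.X * (1 + v + v ^ 2)) :
    evalAtOne (derivT deutschSeries) =
      v ^ 2 * ((1 - v) * (1 + v) ^ 2 * (1 + v + v ^ 2))⁻¹ := by
  rw [PowerSeries.eq_mul_inv_iff_mul_eq (by simp [constantCoeff_of_kernel hv]),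
    evalAtOne_derivT_deutschSeries]
  linear_combination (1 + v + v ^ 2) ^ 2 * (deutsch_gf_mul hv).2 +
    ((PowerSeries.mk fun n => (totalSingleUpRuns n : ℝ)) * (1 - v) * (1 + v + v ^ 2)
      - v - PowerSeries.X * (1 + v + v ^ 2)) * hv

/-! ### Exact formulas by trinomial coefficients -/

/-- The Fourier coefficients of `(1 + 2 cos θ) ^ n`, that is, the trinomial coefficients. -/
noncomputable def trinomialMoment (n k : ℕ) : ℝ :=
  (2 * Real.pi)⁻¹ * ∫ θ in (-Real.pi)..Real.pi, (1 + 2 * Real.cos θ) ^ n * Real.cos (k * θ)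

theorem trinomialMoment_zero (k : ℕ) : trinomialMoment 0 k = if k = 0 then 1 else 0 := by
  have hpi := Real.pi_pos.ne'
  rw [trinomialMoment]
  split_ifs with h
  · subst h
    simp
    field_simp
    ring
  · have hk : (k : ℝ) ≠ 0 := Nat.cast_ne_zero.2 h
    simp only [pow_zero, one_mul]
    rw [intervalIntegral.integral_comp_mul_left (fun x => Real.cos x) hk, integral_cos]
    simp [Real.sin_nat_mul_pi]

theorem intervalIntegrable_trinomial (n k : ℕ) : IntervalIntegrable
    (fun θ => (1 + 2 * Real.cos θ) ^ n * Real.cos (k * θ)) MeasureTheory.volume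
      (-Real.pi) Real.pi :=
  Continuous.intervalIntegrable (by fun_prop) _ _

theorem trinomialMoment_succ_zero (n : ℕ) :
    trinomialMoment (n + 1) 0 = trinomialMoment n 0 + 2 * trinomialMoment n 1 := by
  simp only [trinomialMoment]
  rw [mul_left_comm, ← mul_add, ← intervalIntegral.integral_const_mul (2 : ℝ),
    ← intervalIntegral.integral_add (intervalIntegrable_trinomial n 0)
      ((intervalIntegrable_trinomial n 1).const_mul 2)]
  congr 1
  refine intervalIntegral.integral_congr fun θ _ => ?_
  simp only [Nat.cast_zero, Nat.cast_one, zero_mul, one_mul, Real.cos_zero]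
  ring

theorem trinomialMoment_succ_succ (n k : ℕ) :
    trinomialMoment (n + 1) (k + 1) =
      trinomialMoment n (k + 1) + trinomialMoment n k + trinomialMoment n (k + 2) := by
  simp only [trinomialMoment]
  rw [← mul_add, ← mul_add, ← intervalIntegral.integral_add (intervalIntegrable_trinomial n _)
      (intervalIntegrable_trinomial n _), ← intervalIntegral.integral_add
      ((intervalIntegrable_trinomial n _).add (intervalIntegrable_trinomial n _))
      (intervalIntegrable_trinomial n _)]
  congr 1
  refine intervalIntegral.integral_congr fun θ _ => ?_
  have h1 : (k : ℝ) * θ = (k + 1) * θ - θ := by ring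
  have h2 : ((k : ℝ) + 2) * θ = (k + 1) * θ + θ := by ring
  push_cast
  rw [h1, h2, Real.cos_sub, Real.cos_add]
  ring

/-- The generating function of `trinomialMoment n k` over `n`. -/
noncomputable def trinomialSeries (k : ℕ) : PowerSeries ℝ :=
  PowerSeries.mk fun n => trinomialMoment n k

theorem trinomialSeries_zero_eq :
    trinomialSeries 0 = 1 + PowerSeries.X * (trinomialSeries 0 + 2 * trinomialSeries 1) := by
  ext n
  cases n with
  | zero => simp [trinomialSeries, trinomialMoment_zero]
  | succ n =>
    have h2 : (2 : PowerSeries ℝ) = PowerSeries.C 2 := (map_ofNat _ 2).symm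
    rw [map_add, PowerSeries.coeff_succ_X_mul, h2]
    simp [trinomialSeries, trinomialMoment_succ_zero, PowerSeries.coeff_one,
      PowerSeries.coeff_C_mul]

theorem trinomialSeries_succ_eq (k : ℕ) :
    trinomialSeries (k + 1) = PowerSeries.X *
      (trinomialSeries (k + 1) + trinomialSeries k + trinomialSeries (k + 2)) := by
  ext n
  cases n with
  | zero => simp [trinomialSeries, trinomialMoment_zero]
  | succ n =>
    rw [PowerSeries.coeff_succ_X_mul]
    simp [trinomialSeries, trinomialMoment_succ_succ]

/-- The same z-adic uniqueness argument: v^k S solves the recurrence in k because v = z(1 + v + v²),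
and S is normalised by the equation at k = 0. -/
theorem trinomialSeries_eq_pow_mul {v S : PowerSeries ℝ}
    (hv : v = PowerSeries.X * (1 + v + v ^ 2))
    (hS : S * (1 - PowerSeries.X - 2 * PowerSeries.X * v) = 1) (k : ℕ) :
    trinomialSeries k = v ^ k * S := by
  rw [← sub_eq_zero]
  refine PowerSeries.eq_zero_of_forall_X_pow_dvd fun n => ?_
  induction n generalizing k with
  | zero => simp
  | succ n ih =>
    rw [pow_succ']
    cases k with
    | zero =>
      rw [trinomialSeries_zero_eq]
      convert! mul_dvd_mul_left PowerSeries.X ((ih 0).add ((ih 1).mul_left 2)) using 1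
      linear_combination -hS
    | succ k =>
      rw [trinomialSeries_succ_eq]
      convert! mul_dvd_mul_left PowerSeries.X (((ih (k + 1)).add (ih k)).add (ih (k + 2))) using 1
      linear_combination -v ^ k * S * hv

theorem trinomialSeries_zero_mul {v : PowerSeries ℝ}
    (hv : v = PowerSeries.X * (1 + v + v ^ 2)) :
    trinomialSeries 0 * (1 - v ^ 2) = 1 + v + v ^ 2 ∧
      trinomialSeries 1 = v * trinomialSeries 0 := by
  have hS : (1 - PowerSeries.X - 2 * PowerSeries.X * v)⁻¹ *
      (1 - PowerSeries.X - 2 * PowerSeries.X * v) = 1 :=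
    PowerSeries.inv_mul_cancel _ (by simp)
  generalize (1 - PowerSeries.X - 2 * PowerSeries.X * v)⁻¹ = S at hS
  rw [trinomialSeries_eq_pow_mul hv hS 0, trinomialSeries_eq_pow_mul hv hS 1]
  constructor
  · linear_combination (1 + v + v ^ 2) * hS - S * (1 + 2 * v) * hv
  · ring

theorem deutschCount_eq (n : ℕ) :
    (deutschCount n : ℝ) = trinomialMoment n 0 - trinomialMoment n 1 := by
  obtain ⟨v, hv⟩ : ∃ v : PowerSeries ℝ, v = PowerSeries.X * (1 + v + v ^ 2) :=
    ⟨_, mk_kernelCoeff_eq⟩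
  obtain ⟨h0, h1⟩ := trinomialSeries_zero_mul hv
  have h : (PowerSeries.mk fun n => (deutschCount n : ℝ)) =
      trinomialSeries 0 - trinomialSeries 1 := by
    apply mul_right_cancel₀ (one_add_ne_zero_of_kernel hv)
    rw [deutschCount_gf_mul hv, h1]
    linear_combination -h0
  simpa [trinomialSeries] using congrArg (PowerSeries.coeff n) h

/-- Since (1 + z)T₀ = (1 + v)/(1 - v) = 2/(1 - v) - 1 for T₀ the series of T(n,0), the series z²/((1
+ z)(1 - v)) is half of z²(T₀ + 1/(1 + z)). -/
theorem totalSingleUpRuns_add_two (n : ℕ) :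
    (totalSingleUpRuns (n + 2) : ℝ) = (trinomialMoment n 0 + (-1) ^ n) / 2 := by
  obtain ⟨v, hv⟩ : ∃ v : PowerSeries ℝ, v = PowerSeries.X * (1 + v + v ^ 2) :=
    ⟨_, mk_kernelCoeff_eq⟩
  obtain ⟨h0, -⟩ := trinomialSeries_zero_mul hv
  have hN : (1 + PowerSeries.X) * (PowerSeries.mk fun n => (-1 : ℝ) ^ n) = 1 := by
    ext n
    cases n with
    | zero => simp
    | succ n => simp [add_mul, PowerSeries.coeff_succ_X_mul, PowerSeries.coeff_one, pow_succ]
  have hR : (1 + PowerSeries.X) * trinomialSeries 0 * (1 - v) = 1 + v := by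
    apply mul_right_cancel₀ (one_add_ne_zero_of_kernel hv)
    linear_combination (1 + PowerSeries.X) * h0 - hv
  have hQ := (deutsch_gf_mul hv).2
  have h : PowerSeries.C (2 : ℝ) * (PowerSeries.mk fun n => (totalSingleUpRuns n : ℝ)) =
      PowerSeries.X ^ 2 * (trinomialSeries 0 + PowerSeries.mk fun n => (-1 : ℝ) ^ n) := by
    rw [map_ofNat]
    generalize (PowerSeries.mk fun n => (totalSingleUpRuns n : ℝ)) = Q at *
    generalize (PowerSeries.mk fun n => (-1 : ℝ) ^ n) = N at *
    generalize trinomialSeries 0 = S at *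
    generalize (PowerSeries.X : PowerSeries ℝ) = x at *
    linear_combination -2 * Q * hN + N * (((1 + x) * S + 1) * hQ - (1 + x) * Q * hR) +
      x ^ 2 * S * hN
  have h2 := congrArg (PowerSeries.coeff (n + 2)) h
  rw [PowerSeries.coeff_C_mul, PowerSeries.coeff_X_pow_mul, map_add, PowerSeries.coeff_mk,
    PowerSeries.coeff_mk, trinomialSeries, PowerSeries.coeff_mk] at h2
  linarith

/-! ### Laplace's method for the trinomial integrals -/

open Filter Topology in
theorem tendsto_nat_mul_one_sub_cos (x : ℝ) :
    Tendsto (fun n : ℕ => (n : ℝ) * (1 - Real.cos (x / √n))) atTop (𝓝 (x ^ 2 / 2)) := by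
  have h0 : Tendsto (fun n : ℕ => x / √(n : ℝ) / 2) atTop (𝓝 0) := by
    have : Tendsto (fun n : ℕ => x / √(n : ℝ)) atTop (𝓝 0) :=
      tendsto_const_nhds.div_atTop (Real.tendsto_sqrt_atTop.comp tendsto_natCast_atTop_atTop)
    simpa using this.div_const 2
  have h1 := ((Real.continuous_sinc.tendsto 0).comp h0).pow 2
  rw [Real.sinc_zero] at h1
  have h2 := h1.const_mul (x ^ 2 / 2)
  rw [one_pow, mul_one] at h2
  refine h2.congr' ?_
  filter_upwards [eventually_gt_atTop 0] with n hn
  have hn' : (0 : ℝ) < n := Nat.cast_pos.2 hn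
  have hs : √(n : ℝ) ^ 2 = n := Real.sq_sqrt hn'.le
  have hs0 : √(n : ℝ) ≠ 0 := (Real.sqrt_pos.2 hn').ne'
  have hcos : Real.cos (x / √n) = 1 - 2 * Real.sin (x / √n / 2) ^ 2 := by
    have := Real.cos_sq_add_sin_sq (x / √n / 2)
    have h3 := Real.cos_two_mul (x / √n / 2)
    rw [mul_div_cancel₀ _ (two_ne_zero' ℝ)] at h3
    linarith
  rw [hcos, Function.comp_apply]
  by_cases hx : x = 0
  · simp [hx]
  · rw [Real.sinc_of_ne_zero (by positivity)]
    field_simp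
    rw [hs]
    ring

open Filter Topology in
theorem tendsto_trinomial_kernel (x : ℝ) :
    Tendsto (fun n : ℕ => ((1 + 2 * Real.cos (x / √n)) / 3) ^ n) atTop
      (𝓝 (Real.exp (-(1 / 3) * x ^ 2))) := by
  have h : Tendsto (fun n : ℕ => (n : ℝ) * (-(2 / 3) * (1 - Real.cos (x / √n)))) atTop
      (𝓝 (-(1 / 3) * x ^ 2)) := by
    convert! (tendsto_nat_mul_one_sub_cos x).const_mul (-(2 / 3)) using 1
    · funext n; ring
    · congr 1; ring
  -- The base is 1 - (2/3)(1 - cos(x/√n)), and n times its deviation from 1 tends to -x²/3.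
  refine (Real.tendsto_one_add_pow_exp_of_tendsto h).congr fun n => ?_
  congr 1
  ring

/-- A Gaussian bound on the whole period, so no separate tail estimate is needed. Above, cos y ≤ 1 -
2y²/π² suffices; below, the quotient is at least -1/3 > -1/e. -/
theorem abs_one_add_two_cos_le {y : ℝ} (hy : |y| ≤ Real.pi) :
    |(1 + 2 * Real.cos y) / 3| ≤ Real.exp (-(y ^ 2 / Real.pi ^ 2)) := by
  have hpi := Real.pi_pos
  have hq : y ^ 2 / Real.pi ^ 2 ≤ 1 := by
    rw [div_le_one (by positivity)]
    exact sq_le_sq.2 (by rwa [abs_of_pos hpi])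
  have hq0 : 0 ≤ y ^ 2 / Real.pi ^ 2 := by positivity
  rw [abs_le]
  constructor
  · have h1 : Real.exp (-1) ≤ Real.exp (-(y ^ 2 / Real.pi ^ 2)) :=
      Real.exp_le_exp.2 (by linarith)
    have h2 := Real.exp_neg_one_gt_d9
    have h3 := Real.neg_one_le_cos y
    norm_num at h2
    linarith
  · have h1 := Real.cos_le_one_sub_mul_cos_sq hy
    have h2 := Real.add_one_le_exp (-(y ^ 2 / Real.pi ^ 2))
    have h3 : 2 / Real.pi ^ 2 * y ^ 2 = 2 * (y ^ 2 / Real.pi ^ 2) := by ring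
    linarith

/-- The rescaled integrand of the trinomial integrals. -/
noncomputable def rescaledIntegrand (m n : ℕ) (x : ℝ) : ℝ :=
  ((1 + 2 * Real.cos (x / √n)) / 3) ^ n * (n * (1 - Real.cos (x / √n))) ^ m

theorem abs_rescaledIntegrand_le (m : ℕ) {n : ℕ} (hn : 0 < n) {x : ℝ}
    (hx : |x| ≤ √n * Real.pi) :
    |rescaledIntegrand m n x| ≤ (1 / 2) ^ m * (x ^ (2 * m) *
      Real.exp (-(1 / Real.pi ^ 2) * x ^ 2)) := by
  have hn' : (0 : ℝ) < n := Nat.cast_pos.2 hn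
  have hs0 : 0 < √(n : ℝ) := Real.sqrt_pos.2 hn'
  have hs : √(n : ℝ) ^ 2 = n := Real.sq_sqrt hn'.le
  have hy : |x / √n| ≤ Real.pi := by
    rw [abs_div, abs_of_pos hs0, div_le_iff₀ hs0]
    linarith
  have hb : (n : ℝ) * (1 - Real.cos (x / √n)) ≤ x ^ 2 / 2 := by
    have h1 := Real.one_sub_sq_div_two_le_cos (x := x / √n)
    have h2 : (n : ℝ) * ((x / √n) ^ 2 / 2) = x ^ 2 / 2 := by
      rw [div_pow, hs]; field_simp
    rw [← h2]
    exact mul_le_mul_of_nonneg_left (by linarith) hn'.le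
  have hb0 : 0 ≤ (n : ℝ) * (1 - Real.cos (x / √n)) :=
    mul_nonneg hn'.le (by linarith [Real.cos_le_one (x / √n)])
  rw [rescaledIntegrand, abs_mul, abs_pow, abs_pow, abs_of_nonneg hb0]
  calc |(1 + 2 * Real.cos (x / √n)) / 3| ^ n * ((n : ℝ) * (1 - Real.cos (x / √n))) ^ m
      ≤ Real.exp (-((x / √n) ^ 2 / Real.pi ^ 2)) ^ n * (x ^ 2 / 2) ^ m := by
        gcongr
        exact abs_one_add_two_cos_le hy
    _ = (1 / 2) ^ m * (x ^ (2 * m) * Real.exp (-(1 / Real.pi ^ 2) * x ^ 2)) := by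
        rw [← Real.exp_nat_mul]
        have : (n : ℝ) * -((x / √n) ^ 2 / Real.pi ^ 2) = -(1 / Real.pi ^ 2) * x ^ 2 := by
          rw [div_pow, hs]
          field_simp
        rw [this, pow_mul, div_pow, div_pow]
        ring

theorem integrable_pow_mul_gaussian (m : ℕ) {b : ℝ} (hb : 0 < b) :
    MeasureTheory.Integrable fun x : ℝ => x ^ m * Real.exp (-b * x ^ 2) := by
  have h := integrable_rpow_mul_exp_neg_mul_sq hb (s := m)
    (by linarith [(Nat.cast_nonneg m : (0 : ℝ) ≤ m)])
  simpa only [Real.rpow_natCast] using h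

open Filter Topology MeasureTheory in
-- The growing interval becomes an indicator on the line, allowing dominated convergence. The case m
-- = 0 serves s_n, and m = 1 serves d_n.
theorem tendsto_integral_rescaledIntegrand (m : ℕ) :
    Tendsto (fun n : ℕ => ∫ x in (-(√n * Real.pi))..(√n * Real.pi), rescaledIntegrand m n x)
      atTop (𝓝 (∫ x : ℝ, Real.exp (-(1 / 3) * x ^ 2) * (x ^ 2 / 2) ^ m)) := by
  have hpi := Real.pi_pos
  have hcont : ∀ n, Continuous (rescaledIntegrand m n) := fun n => by
    unfold rescaledIntegrand; fun_prop
  have key : Tendsto (fun n : ℕ => ∫ x : ℝ,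
      (Set.Ioc (-(√n * Real.pi)) (√n * Real.pi)).indicator (rescaledIntegrand m n) x)
      atTop (𝓝 (∫ x : ℝ, Real.exp (-(1 / 3) * x ^ 2) * (x ^ 2 / 2) ^ m)) := by
    refine tendsto_integral_of_dominated_convergence
      (fun x => (1 / 2) ^ m * (x ^ (2 * m) * Real.exp (-(1 / Real.pi ^ 2) * x ^ 2)))
      (fun n => (hcont n).aestronglyMeasurable.indicator measurableSet_Ioc)
      ((integrable_pow_mul_gaussian (2 * m) (by positivity)).const_mul _)
      (fun n => Eventually.of_forall fun x => ?_) (Eventually.of_forall fun x => ?_)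
    · have hnonneg : 0 ≤ (1 / 2 : ℝ) ^ m *
          (x ^ (2 * m) * Real.exp (-(1 / Real.pi ^ 2) * x ^ 2)) := by
        rw [pow_mul]; positivity
      rw [Real.norm_eq_abs]
      by_cases hx : x ∈ Set.Ioc (-(√n * Real.pi)) (√(n : ℝ) * Real.pi)
      · rw [Set.indicator_of_mem hx]
        have hn : 0 < n := by
          rcases Nat.eq_zero_or_pos n with rfl | h
          · simp at hx
          · exact h
        exact abs_rescaledIntegrand_le m hn (abs_le.2 ⟨hx.1.le, hx.2⟩)
      · rw [Set.indicator_of_notMem hx, abs_zero]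
        exact hnonneg
    · have h1 := (tendsto_trinomial_kernel x).mul ((tendsto_nat_mul_one_sub_cos x).pow m)
      refine h1.congr' ?_
      have h2 : Tendsto (fun n : ℕ => √(n : ℝ) * Real.pi) atTop atTop :=
        (Real.tendsto_sqrt_atTop.comp tendsto_natCast_atTop_atTop).atTop_mul_const hpi
      filter_upwards [h2.eventually_gt_atTop |x|] with n hn
      rw [Set.indicator_of_mem (Set.mem_Ioc.2 ⟨(abs_lt.1 hn).1, (abs_lt.1 hn).2.le⟩),
        rescaledIntegrand]
  refine key.congr fun n => ?_
  rw [integral_indicator measurableSet_Ioc, intervalIntegral.integral_of_le]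
  have : 0 ≤ √(n : ℝ) * Real.pi := by positivity
  linarith

theorem integral_trinomial_rescale (m n : ℕ) :
    √(n : ℝ) * ((n : ℝ) ^ m * ∫ θ in (-Real.pi)..Real.pi,
      (1 + 2 * Real.cos θ) ^ n * (1 - Real.cos θ) ^ m) =
    3 ^ n * ∫ x in (-(√n * Real.pi))..(√n * Real.pi), rescaledIntegrand m n x := by
  rcases Nat.eq_zero_or_pos n with rfl | hn
  · simp
  have hs0 : √(n : ℝ) ≠ 0 := (Real.sqrt_pos.2 (Nat.cast_pos.2 hn)).ne'
  have h := intervalIntegral.smul_integral_comp_mul_left (a := -Real.pi) (b := Real.pi)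
    (rescaledIntegrand m n) (√(n : ℝ))
  rw [mul_neg] at h
  rw [← h, smul_eq_mul, mul_left_comm (3 ^ n : ℝ)]
  congr 1
  rw [← intervalIntegral.integral_const_mul, ← intervalIntegral.integral_const_mul]
  refine intervalIntegral.integral_congr fun θ _ => ?_
  simp only [rescaledIntegrand, mul_div_cancel_left₀ _ hs0, div_pow, mul_pow]
  field_simp

/-! ### Gaussian constants and the asymptotic equivalences -/

theorem integral_exp_neg_third_mul_sq :
    ∫ x : ℝ, Real.exp (-(1 / 3) * x ^ 2) = √3 * √Real.pi := by
  rw [integral_gaussian, ← Real.sqrt_mul (by norm_num)]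
  congr 1
  ring

theorem integral_exp_neg_third_mul_sq_mul_sq :
    ∫ x : ℝ, Real.exp (-(1 / 3) * x ^ 2) * (x ^ 2 / 2) = 3 / 4 * (√3 * √Real.pi) := by
  have h := integral_comp_abs (f := fun x => Real.exp (-(1 / 3) * x ^ 2) * (x ^ 2 / 2))
  simp only [sq_abs] at h
  have h2 := integral_rpow_mul_exp_neg_mul_rpow (p := 2) (q := 2) (b := 1 / 3) two_pos
    (by norm_num) (by norm_num)
  have h3 : Real.Gamma ((2 + 1) / 2) = √Real.pi / 2 := by
    rw [show ((2 : ℝ) + 1) / 2 = 1 / 2 + 1 by norm_num, Real.Gamma_add_one (by norm_num),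
      Real.Gamma_one_half_eq]
    ring
  have h4 : (1 / 3 : ℝ) ^ (-((2 : ℝ) + 1) / 2) = 3 * √3 := by
    rw [one_div, Real.inv_rpow (by norm_num), ← Real.rpow_neg (by norm_num),
      show -(-((2 : ℝ) + 1) / 2) = 1 + 1 / 2 by norm_num, Real.rpow_add (by norm_num),
      Real.rpow_one, ← Real.sqrt_eq_rpow]
  rw [h3, h4] at h2
  simp only [Real.rpow_two] at h2
  rw [h]
  have h5 : ∫ x in Set.Ioi (0 : ℝ), Real.exp (-(1 / 3) * x ^ 2) * (x ^ 2 / 2) =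
      1 / 2 * ∫ x in Set.Ioi (0 : ℝ), x ^ 2 * Real.exp (-(1 / 3) * x ^ 2) := by
    rw [← MeasureTheory.integral_const_mul]
    congr 1
    funext x
    ring
  rw [h5, h2]
  ring

open Filter Topology in
theorem tendsto_sqrt_mul_trinomialMoment_zero :
    Tendsto (fun n : ℕ => √(n : ℝ) * trinomialMoment n 0 / 3 ^ n) atTop
      (𝓝 ((2 * Real.pi)⁻¹ * (√3 * √Real.pi))) := by
  have h := (tendsto_integral_rescaledIntegrand 0).const_mul (2 * Real.pi)⁻¹
  simp only [pow_zero, mul_one] at h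
  rw [integral_exp_neg_third_mul_sq] at h
  refine h.congr fun n => ?_
  have h2 := integral_trinomial_rescale 0 n
  simp only [pow_zero, mul_one, one_mul] at h2
  rw [eq_div_iff (by positivity), trinomialMoment, mul_left_comm]
  simp only [Nat.cast_zero, zero_mul, Real.cos_zero, mul_one]
  rw [h2]
  ring

open Filter Topology in
theorem tendsto_deutschCount :
    Tendsto (fun n : ℕ => √(n : ℝ) * n * deutschCount n / 3 ^ n) atTop
      (𝓝 ((2 * Real.pi)⁻¹ * (3 / 4 * (√3 * √Real.pi)))) := by
  have h := (tendsto_integral_rescaledIntegrand 1).const_mul (2 * Real.pi)⁻¹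
  simp only [pow_one] at h
  rw [integral_exp_neg_third_mul_sq_mul_sq] at h
  refine h.congr fun n => ?_
  have h2 := integral_trinomial_rescale 1 n
  simp only [pow_one] at h2
  have h3 : (deutschCount n : ℝ) = (2 * Real.pi)⁻¹ * ∫ θ in (-Real.pi)..Real.pi,
      (1 + 2 * Real.cos θ) ^ n * (1 - Real.cos θ) := by
    rw [deutschCount_eq, trinomialMoment, trinomialMoment, ← mul_sub,
      ← intervalIntegral.integral_sub (intervalIntegrable_trinomial n 0)
        (intervalIntegrable_trinomial n 1)]
    congr 1
    refine intervalIntegral.integral_congr fun θ _ => ?_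
    simp only [Nat.cast_zero, Nat.cast_one, zero_mul, one_mul, Real.cos_zero]
    ring
  rw [h3, eq_div_iff (by positivity)]
  linear_combination -(2 * Real.pi)⁻¹ * h2

open Filter Topology in
-- The constant 18 is 2 · 3²: the halving in the exact formula and the index shift by two. The shift
-- also changes √n by a factor tending to 1, and (-1)^n is negligible against 3^n/√n.
theorem tendsto_totalSingleUpRuns :
    Tendsto (fun n : ℕ => √(n : ℝ) * totalSingleUpRuns n / 3 ^ n) atTop
      (𝓝 ((2 * Real.pi)⁻¹ * (√3 * √Real.pi) / 18)) := by
  rw [← tendsto_add_atTop_iff_nat 2]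
  have hr : Tendsto (fun n : ℕ => √(((n + 2 : ℕ) : ℝ) / n)) atTop (𝓝 1) := by
    rw [← Real.sqrt_one]
    refine (Real.continuous_sqrt.tendsto 1).comp ?_
    have h1 : Tendsto (fun n : ℕ => 1 + 2 / (n : ℝ)) atTop (𝓝 (1 + 0)) :=
      tendsto_const_nhds.add (tendsto_const_div_atTop_nhds_zero_nat 2)
    rw [add_zero] at h1
    refine h1.congr' ?_
    filter_upwards [eventually_gt_atTop 0] with n hn
    have : (n : ℝ) ≠ 0 := Nat.cast_ne_zero.2 hn.ne'
    push_cast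
    field_simp
  have he : Tendsto (fun n : ℕ => √(n : ℝ) * (-1) ^ n / 3 ^ n) atTop (𝓝 0) := by
    have h1 : Tendsto (fun n : ℕ => (n : ℝ) ^ 1 * (1 / 3 : ℝ) ^ n) atTop (𝓝 0) :=
      tendsto_pow_const_mul_const_pow_of_lt_one 1 (by norm_num) (by norm_num)
    refine squeeze_zero_norm (fun n => ?_) h1
    rw [norm_div, norm_mul, norm_pow, norm_pow]
    simp only [Real.norm_eq_abs, abs_neg, abs_one, one_pow, mul_one, pow_one]
    rw [abs_of_nonneg (Real.sqrt_nonneg _), abs_of_pos (by norm_num : (0 : ℝ) < 3),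
      one_div_pow, mul_one_div]
    gcongr
    rcases Nat.eq_zero_or_pos n with rfl | hn
    · simp
    · have h1n : (1 : ℝ) ≤ n := Nat.one_le_cast.2 hn
      exact Real.sqrt_le_iff.2 ⟨by positivity, by nlinarith⟩
  have h := (hr.mul (tendsto_sqrt_mul_trinomialMoment_zero.add he)).div_const 18
  rw [one_mul, add_zero] at h
  refine h.congr' ?_
  filter_upwards [eventually_gt_atTop 0] with n hn
  have hn' : (0 : ℝ) < n := Nat.cast_pos.2 hn
  have hs0 : √(n : ℝ) ≠ 0 := (Real.sqrt_pos.2 hn').ne'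
  rw [totalSingleUpRuns_add_two, Real.sqrt_div (Nat.cast_nonneg _), pow_add]
  field_simp
  ring

open Filter Topology Asymptotics in
theorem isEquivalent_totalSingleUpRuns :
    IsEquivalent atTop (fun n : ℕ => (totalSingleUpRuns n : ℝ))
      (fun n : ℕ => √3 / 36 * (3 : ℝ) ^ n / √(Real.pi * n)) := by
  have hpi : 0 < √Real.pi := Real.sqrt_pos.2 Real.pi_pos
  have h3 : 0 < √(3 : ℝ) := by positivity
  have hp : √Real.pi ^ 2 = Real.pi := Real.sq_sqrt Real.pi_pos.le
  have hne : ∀ᶠ n : ℕ in atTop, √3 / 36 * (3 : ℝ) ^ n / √(Real.pi * n) ≠ 0 := by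
    filter_upwards [eventually_gt_atTop 0] with n hn
    have := Real.pi_pos
    have : (0 : ℝ) < n := Nat.cast_pos.2 hn
    positivity
  rw [isEquivalent_iff_tendsto_one hne]
  have h := tendsto_totalSingleUpRuns.div_const ((2 * Real.pi)⁻¹ * (√3 * √Real.pi) / 18)
  rw [div_self (by have := Real.pi_pos; positivity)] at h
  refine h.congr' ?_
  filter_upwards [eventually_gt_atTop 0] with n hn
  have hs : 0 < √(n : ℝ) := Real.sqrt_pos.2 (Nat.cast_pos.2 hn)
  rw [Pi.div_apply, Real.sqrt_mul Real.pi_pos.le]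
  nth_rewrite 1 [← hp]
  field_simp
  ring

open Filter Topology Asymptotics in
theorem isEquivalent_deutschCount :
    IsEquivalent atTop (fun n : ℕ => (deutschCount n : ℝ))
      (fun n : ℕ => 3 * √3 / 8 * (3 : ℝ) ^ n / (√Real.pi * (n : ℝ) ^ (3 / 2 : ℝ))) := by
  have hpi : 0 < √Real.pi := Real.sqrt_pos.2 Real.pi_pos
  have h3 : 0 < √(3 : ℝ) := by positivity
  have hp : √Real.pi ^ 2 = Real.pi := Real.sq_sqrt Real.pi_pos.le
  have hne : ∀ᶠ n : ℕ in atTop,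
      3 * √3 / 8 * (3 : ℝ) ^ n / (√Real.pi * (n : ℝ) ^ (3 / 2 : ℝ)) ≠ 0 := by
    filter_upwards [eventually_gt_atTop 0] with n hn
    have : (0 : ℝ) < n := Nat.cast_pos.2 hn
    positivity
  rw [isEquivalent_iff_tendsto_one hne]
  have h := tendsto_deutschCount.div_const ((2 * Real.pi)⁻¹ * (3 / 4 * (√3 * √Real.pi)))
  rw [div_self (by have := Real.pi_pos; positivity)] at h
  refine h.congr' ?_
  filter_upwards [eventually_gt_atTop 0] with n hn
  have hn' : (0 : ℝ) < n := Nat.cast_pos.2 hn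
  have hs : 0 < √(n : ℝ) := Real.sqrt_pos.2 hn'
  have hr : (n : ℝ) ^ (3 / 2 : ℝ) = n * √n := by
    rw [show (3 / 2 : ℝ) = 1 + 1 / 2 by norm_num, Real.rpow_add hn', Real.rpow_one,
      ← Real.sqrt_eq_rpow]
  rw [Pi.div_apply, hr]
  nth_rewrite 1 [← hp]
  field_simp
  ring

open Filter Asymptotics in
theorem isEquivalent_averageSingleUpRuns :
    IsEquivalent atTop averageSingleUpRuns (fun n : ℕ => 2 * (n : ℝ) / 27) := by
  refine (isEquivalent_totalSingleUpRuns.div isEquivalent_deutschCount).congr_right ?_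
  filter_upwards [eventually_gt_atTop 0] with n hn
  have hn' : (0 : ℝ) < n := Nat.cast_pos.2 hn
  have hs : 0 < √(n : ℝ) := Real.sqrt_pos.2 hn'
  have hpi : 0 < √Real.pi := Real.sqrt_pos.2 Real.pi_pos
  have hr : (n : ℝ) ^ (3 / 2 : ℝ) = n * √n := by
    rw [show (3 / 2 : ℝ) = 1 + 1 / 2 by norm_num, Real.rpow_add hn', Real.rpow_one,
      ← Real.sqrt_eq_rpow]
  rw [Pi.div_apply, hr, Real.sqrt_mul Real.pi_pos.le]
  field_simp
  norm_num

theorem mainTheorem1 :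
    (∃! v : PowerSeries ℝ, PowerSeries.X = v * (1 + v + v ^ 2)⁻¹) ∧
    (∀ v : PowerSeries ℝ, PowerSeries.X = v * (1 + v + v ^ 2)⁻¹ →
      evalAtOne deutschSeries = (1 + v + v ^ 2) * (1 + v)⁻¹ ∧
      evalAtOne (derivT deutschSeries) =
        v ^ 2 * ((1 - v) * (1 + v) ^ 2 * (1 + v + v ^ 2))⁻¹) ∧
    Asymptotics.IsEquivalent Filter.atTop
      (fun n : ℕ => (totalSingleUpRuns n : ℝ))
      (fun n : ℕ => Real.sqrt 3 / 36 * (3 : ℝ) ^ n / Real.sqrt (Real.pi * n)) ∧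
    Asymptotics.IsEquivalent Filter.atTop
      (fun n : ℕ => (deutschCount n : ℝ))
      (fun n : ℕ => 3 * Real.sqrt 3 / 8 * (3 : ℝ) ^ n /
        (Real.sqrt Real.pi * (n : ℝ) ^ (3 / 2 : ℝ))) ∧
    Asymptotics.IsEquivalent Filter.atTop
      averageSingleUpRuns
      (fun n : ℕ => 2 * (n : ℝ) / 27) := by
  exact ⟨existsUnique_kernel, fun v hv =>
    ⟨evalAtOne_deutschSeries_eq ((X_eq_mul_inv_iff v).1 hv),
      evalAtOne_derivT_deutschSeries_eq ((X_eq_mul_inv_iff v).1 hv)⟩,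
    isEquivalent_totalSingleUpRuns, isEquivalent_deutschCount,
    isEquivalent_averageSingleUpRuns⟩
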